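/- A \emph{network with $k$ terminals} is a finite (simple, undirected) graph with non-negative real edge costs together with a set $Q$ of $k$ of its vertices, called terminals. For $S \subseteq Q$, a \emph{minimum $S$-separating cut} of such a network is a set $X$ of vertices with $X \cap Q = S$ for which the total cost of the edges with exactly one endpoint in $X$ is as small as possible; this smallest total is the cost of the cut. A \emph{mimicking network} for a network $G$ with terminal set $Q$ is a network $G'$ with the same terminal set $Q \subseteq V(G')$ such that, for every partition $Q = S \uplus \bar S$, the minimum $S$-separating cuts of $G$ and of $G'$ have the same cost. (The network $G'$ may have any number of vertices and need not be planar.) \textbf{Theorem.} For every integer $k \ge 3$ there exists a planar graph $G$ with a set $Q$ of $k$ terminals and a positive edge cost function such that every mimicking network for $G$ has at least $2^{k-2}$ edges. -/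

import Mathlib

/-- `A` is an arc in the plane with endpoints `p` and `q`: the image of an injective continuous
map from `[0, 1]` to the plane that sends `0` to `p` and `1` to `q`. -/
def IsPlaneArc (A : Set (ℝ × ℝ)) (p q : ℝ × ℝ) : Prop :=
  ∃ γ : unitInterval → ℝ × ℝ,
    Continuous γ ∧ Function.Injective γ ∧ γ 0 = p ∧ γ 1 = q ∧ Set.range γ = A

/-- A drawing of a simple graph in the plane without crossings. Vertices are distinct points,
each edge is an arc between its two endpoints, an arc contains no vertex other than its endpoints,
and two arcs of different edges meet only in common endpoints.
(The value of `arc` at a pair that is not an edge is irrelevant.) -/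
structure PlaneDrawing {V : Type*} (G : SimpleGraph V) where
  point : V → ℝ × ℝ
  arc : Sym2 V → Set (ℝ × ℝ)
  point_injective : Function.Injective point
  isPlaneArc : ∀ u v, G.Adj u v → IsPlaneArc (arc s(u, v)) (point u) (point v)
  mem_of_point_mem : ∀ e ∈ G.edgeSet, ∀ w, point w ∈ arc e → w ∈ e
  inter_subset : ∀ e ∈ G.edgeSet, ∀ f ∈ G.edgeSet, e ≠ f →
    ∀ x, x ∈ arc e → x ∈ arc f → ∃ w, w ∈ e ∧ w ∈ f ∧ x = point w

/-- A graph is planar if it can be drawn in the plane without crossings. -/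
def IsPlanarGraph {V : Type*} (G : SimpleGraph V) : Prop :=
  Nonempty (PlaneDrawing G)

/-- An edge-weighted graph on the vertex set `V` with `k` distinct vertices singled out as
terminals, which are labelled by `Fin k`. Only the costs of edges of the graph matter. -/
structure TerminalNetwork (k : ℕ) (V : Type*) where
  graph : SimpleGraph V
  cost : Sym2 V → ℝ
  cost_nonneg : ∀ e ∈ graph.edgeSet, 0 ≤ cost e
  terminal : Fin k ↪ V

namespace TerminalNetwork

variable {k : ℕ} {V W : Type*}

/-- The edges with exactly one endpoint in `X`. -/
def cutEdges (N : TerminalNetwork k V) (X : Set V) : Set (Sym2 V) :=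
  {e | e ∈ N.graph.edgeSet ∧ ∃ u ∈ X, ∃ v ∉ X, e = s(u, v)}

/-- The total cost of the edges between `X` and its complement (used for finite `V`). -/
noncomputable def cutCost (N : TerminalNetwork k V) (X : Set V) : ℝ :=
  ∑ᶠ e ∈ N.cutEdges X, N.cost e

/-- The vertex set `X` separates the terminals in `S` from all other terminals. -/
def Separates (N : TerminalNetwork k V) (S : Set (Fin k)) (X : Set V) : Prop :=
  ∀ i, N.terminal i ∈ X ↔ i ∈ S

/-- The cost of a minimum `S`-separating cut. -/
noncomputable def minCut (N : TerminalNetwork k V) (S : Set (Fin k)) : ℝ :=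
  sInf {c | ∃ X : Set V, N.Separates S X ∧ N.cutCost X = c}

/-- In a finite network the infimum in the definition of `minCut` is attained. -/
theorem isLeast_minCut [Finite V] (N : TerminalNetwork k V) (S : Set (Fin k)) :
    IsLeast {c | ∃ X : Set V, N.Separates S X ∧ N.cutCost X = c} (N.minCut S) := by
  have hfin : {c | ∃ X : Set V, N.Separates S X ∧ N.cutCost X = c}.Finite := by
    refine (Set.finite_range (fun X : Set V => N.cutCost X)).subset ?_
    rintro c ⟨X, -, rfl⟩
    exact ⟨X, rfl⟩
  have hne : {c | ∃ X : Set V, N.Separates S X ∧ N.cutCost X = c}.Nonempty := by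
    refine ⟨_, N.terminal '' S, fun i => ?_, rfl⟩
    exact N.terminal.injective.mem_set_image
  exact ⟨hne.csInf_mem hfin, fun c hc => csInf_le hfin.bddBelow hc⟩

/-- `M` is a mimicking network for `N`: it has the same terminals (with the same labels), and for
every partition of the terminals into `S` and its complement the minimum `S`-separating cuts of
`N` and of `M` have the same cost. -/
def IsMimickingNetwork (M : TerminalNetwork k W) (N : TerminalNetwork k V) : Prop :=
  ∀ S : Set (Fin k), M.minCut S = N.minCut S

end TerminalNetwork

/-! Every minimum-cut value is a sum of edge costs. Hence rationally independent minimum-cut values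
force at least that many edges in every mimicking network
(`card_le_ncard_edgeSet_of_linearIndependent_minCut`). It suffices to find natural-number costs and
2^(k-2) bipartitions, each with a private edge: one that lies in all its own minimum cuts and in
none of the others'. Perturbing the costs slightly to rationally independent ones then makes the
minimum-cut values independent (`exists_perturbation`).

Write k = d + 3 and n = 2^d. The network is a grid with rows 0, …, 2n; the terminals are the two
ends of column 0 and the middles of columns 0, n, …, dn. Heavy weights force a cheap cut to cross
each of these columns exactly once, at a height j_i, where j_0 is 0 or n; the middle terminal
prescribes whether n ≤ j_i. In the strip between two such columns, paths join row 2b on the left to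
rows b and b + n on the right. Fewest of them are cut exactly when j_{i+1} is j_i halved, plus n if
the terminal demands it (`stripCost_le_of_shift`). Strip weights are decreasing powers of 2n + 1, so
earlier strips take precedence (`eq_of_digits_le`).

The heights thus act as a shift register loading the bits of a number F < 2^(d+1), and every minimum
cut crosses the last column just below row F (`iff_le_of_gridCost_le`, with `gridCost_le` for the
competing explicit cut). That edge is private to F. -/

/-! ### Rationally independent costs and perturbation -/

theorem exists_linearIndependent_mem_Ioo {ι : Type*} [Finite ι] (a : ι → ℝ) (ha : ∀ i, 0 ≤ a i)
    {ε : ℝ} (hε : 0 < ε) :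
    ∃ c : ι → ℝ, LinearIndependent ℚ c ∧ ∀ i, c i ∈ Set.Ioo (a i) (a i + ε) := by
  classical
  have := Fintype.ofFinite ι
  obtain ⟨u, hu⟩ : ∃ u : ι → ℝ, LinearIndependent ℚ u := by
    have hb := (Module.Basis.ofVectorSpace ℚ ℝ).linearIndependent
    have hinf : Infinite (Module.Basis.ofVectorSpaceIndex ℚ ℝ) := by
      rw [Cardinal.infinite_iff, (Module.Basis.ofVectorSpace ℚ ℝ).mk_eq_rank'', Real.rank_rat_real]
      exact Cardinal.aleph0_le_continuum
    have e : ι ↪ Module.Basis.ofVectorSpaceIndex ℚ ℝ :=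
      (Fintype.equivFin ι).toEmbedding.trans (Fin.valEmbedding.trans (Infinite.natEmbedding _))
    exact ⟨_, hb.comp e e.injective⟩
  have hu0 : ∀ i, u i ≠ 0 := fun i => hu.ne_zero i
  -- Rescaling by nonzero rationals preserves independence, and density lets it reach any nonempty
  -- open interval.
  have key : ∀ i, ∃ q : ℚ, (q : ℝ) * u i ∈ Set.Ioo (a i) (a i + ε) := by
    intro i
    rcases lt_or_gt_of_ne (hu0 i) with h | h
    · obtain ⟨q, h1, h2⟩ := exists_rat_btwn (show (a i + ε) / u i < a i / u i from
        div_lt_div_of_neg_of_lt h (by linarith))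
      exact ⟨q, (lt_div_iff_of_neg h).1 h2, (div_lt_iff_of_neg h).1 h1⟩
    · obtain ⟨q, h1, h2⟩ := exists_rat_btwn (show a i / u i < (a i + ε) / u i from
        div_lt_div_of_pos_right (by linarith) h)
      exact ⟨q, (div_lt_iff₀ h).1 h1, (lt_div_iff₀ h).1 h2⟩
  choose q hq using key
  have hq0 : ∀ i, q i ≠ 0 := by
    intro i h0
    have := (hq i).1
    simp [h0] at this
    linarith [ha i]
  refine ⟨fun i => q i • u i, hu.units_smul (fun i => Units.mk0 (q i) (hq0 i)), fun i => ?_⟩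
  simpa [Rat.smul_def] using hq i

namespace TerminalNetwork

variable {k : ℕ} {V W : Type*}

theorem cutCost_eq_sum [Finite V] (N : TerminalNetwork k V) (X : Set V) :
    N.cutCost X = ∑ e ∈ (N.cutEdges X).toFinite.toFinset, N.cost e := by
  rw [cutCost, finsum_mem_eq_finite_toFinset_sum]

/-- Each minimum is attained, so it lies in the rational span of the edge costs, whose dimension is
at most the number of edges. -/
theorem card_le_ncard_edgeSet_of_linearIndependent_minCut [Finite W] (M : TerminalNetwork k W)
    {ι : Type*} [Fintype ι] (S : ι → Set (Fin k))
    (h : LinearIndependent ℚ fun i => M.minCut (S i)) :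
    Fintype.card ι ≤ M.graph.edgeSet.ncard := by
  classical
  have hfin : (M.cost '' M.graph.edgeSet).Finite := Set.toFinite _
  have := hfin.fintype
  have h1 := linearIndependent_le_span_aux' _ h (M.cost '' M.graph.edgeSet) (by
    rintro _ ⟨i, rfl⟩
    obtain ⟨X, -, hX⟩ := (M.isLeast_minCut (S i)).1
    simp only [SetLike.mem_coe]
    rw [← hX, cutCost_eq_sum]
    refine Submodule.sum_mem _ fun e he => Submodule.subset_span ⟨e, ?_, rfl⟩
    exact ((Set.Finite.mem_toFinset _).1 he).1)
  calc Fintype.card ι ≤ _ := h1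
    _ = (M.cost '' M.graph.edgeSet).ncard := by rw [Set.ncard_eq_toFinset_card', Set.toFinset_card]
    _ ≤ _ := Set.ncard_image_le (Set.toFinite _)

/-- Integer costs can be perturbed so that all mimicking networks are large, provided that there
are many terminal bipartitions whose minimum cuts each contain a private edge. -/
theorem exists_perturbation [Finite V] (N : TerminalNetwork k V)
    (hN : ∀ e, ∃ c : ℕ, N.cost e = c) {ι : Type*} [Fintype ι] (S : ι → Set (Fin k))
    (e : ι → Sym2 V) (X : ι → Set V) (hX : ∀ i, N.Separates (S i) (X i))
    (he : ∀ i Y, N.Separates (S i) Y → N.cutCost Y ≤ N.cutCost (X i) →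
      ∀ l, e l ∈ N.cutEdges Y ↔ l = i) :
    ∃ N' : TerminalNetwork k V, N'.graph = N.graph ∧ (∀ e ∈ N'.graph.edgeSet, 0 < N'.cost e) ∧
      ∀ (W : Type*) [Finite W] (M : TerminalNetwork k W), M.IsMimickingNetwork N' →
        Fintype.card ι ≤ M.graph.edgeSet.ncard := by
  classical
  have := Fintype.ofFinite V
  have hN0 : ∀ e, 0 ≤ N.cost e := fun e => by
    obtain ⟨c, hc⟩ := hN e
    rw [hc]
    positivity
  -- With this bound per edge, the total perturbation of any cut stays below 1, the gap between
  -- distinct integer cut values.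
  obtain ⟨c, hc, hcI⟩ := exists_linearIndependent_mem_Ioo N.cost hN0
    (ε := 1 / (Fintype.card (Sym2 V) + 1)) (by positivity)
  let N' : TerminalNetwork k V :=
    { graph := N.graph
      cost := c
      cost_nonneg := fun e _ => (hN0 e).trans (hcI e).1.le
      terminal := N.terminal }
  have hle : ∀ Y, N.cutCost Y ≤ N'.cutCost Y := by
    intro Y
    rw [cutCost_eq_sum, cutCost_eq_sum]
    exact Finset.sum_le_sum fun e _ => (hcI e).1.le
  have hlt : ∀ Y, N'.cutCost Y < N.cutCost Y + 1 := by
    intro Y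
    rw [cutCost_eq_sum, cutCost_eq_sum]
    set F := (N.cutEdges Y).toFinite.toFinset
    have h1 : ∑ e ∈ F, c e ≤ ∑ e ∈ F, (N.cost e + 1 / (Fintype.card (Sym2 V) + 1)) :=
      Finset.sum_le_sum fun e _ => (hcI e).2.le
    have h2 : (F.card : ℝ) ≤ Fintype.card (Sym2 V) := by exact_mod_cast F.card_le_univ
    have h3 : (F.card : ℝ) * (1 / (Fintype.card (Sym2 V) + 1)) < 1 := by
      rw [mul_one_div, div_lt_one (by positivity)]
      linarith
    rw [Finset.sum_add_distrib, Finset.sum_const, nsmul_eq_mul] at h1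
    exact lt_of_le_of_lt h1 (by linarith)
  have hint : ∀ Y, ∃ z : ℕ, N.cutCost Y = z := by
    intro Y
    choose z hz using hN
    exact ⟨∑ e ∈ (N.cutEdges Y).toFinite.toFinset, z e, by simp [cutCost_eq_sum, hz]⟩
  have hmin : ∀ i, ∃ Y, (∀ l, e l ∈ N.cutEdges Y ↔ l = i) ∧ N'.cutCost Y = N'.minCut (S i) := by
    intro i
    obtain ⟨⟨Y, hY, hYc⟩, hl⟩ := N'.isLeast_minCut (S i)
    refine ⟨Y, he i Y hY ?_, hYc⟩
    have h1 : N'.minCut (S i) ≤ N'.cutCost (X i) := hl ⟨X i, hX i, rfl⟩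
    have h2 := hle Y
    have h3 := hlt (X i)
    obtain ⟨y, hy⟩ := hint Y
    obtain ⟨x, hx⟩ := hint (X i)
    rw [hy] at h2 ⊢
    rw [hx] at h3 ⊢
    have : (y : ℝ) < x + 1 := by linarith
    exact_mod_cast Nat.lt_succ_iff.1 (by exact_mod_cast this)
  choose Y hYe hYc using hmin
  have hind : LinearIndependent ℚ fun i => N'.minCut (S i) := by
    rw [Fintype.linearIndependent_iff] at hc ⊢
    intro g hg l
    -- Regroup the vanishing combination by edges: at the private edge `e l` only the cut of `l`
    -- contributes, so the coefficient there is `g l`.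
    have h1 : ∑ f : Sym2 V, (∑ i, if f ∈ N.cutEdges (Y i) then g i else 0) • c f = 0 := by
      rw [← hg]
      simp_rw [Finset.sum_smul]
      rw [Finset.sum_comm]
      refine Finset.sum_congr rfl fun i _ => ?_
      rw [← hYc, cutCost_eq_sum, Finset.smul_sum]
      simp only [ite_smul, zero_smul]
      rw [← Finset.sum_filter]
      refine Finset.sum_congr ?_ fun _ _ => rfl
      ext f
      simp only [Finset.mem_filter, Finset.mem_univ, true_and, Set.Finite.mem_toFinset]
      exact Iff.rfl
    have h2 := hc _ h1 (e l)
    simpa [hYe] using h2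
  refine ⟨N', rfl, fun e _ => (hN0 e).trans_lt (hcI e).1, fun W _ M hM => ?_⟩
  refine M.card_le_ncard_edgeSet_of_linearIndependent_minCut S ?_
  simpa only [hM _] using hind

end TerminalNetwork

/-! ### The grid and its straight-line drawing -/

/-- The grid with columns `0, …, w` and rows `0, …, h`. -/
def gridGraph (w h : ℕ) : SimpleGraph (Fin (w + 1) × Fin (h + 1)) where
  Adj p q := (p.2 = q.2 ∧ ((p.1 : ℕ) + 1 = q.1 ∨ (q.1 : ℕ) + 1 = p.1)) ∨
    (p.1 = q.1 ∧ ((p.2 : ℕ) + 1 = q.2 ∨ (q.2 : ℕ) + 1 = p.2))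
  symm := ⟨by
    intro p q h
    rcases h with ⟨h, h'⟩ | ⟨h, h'⟩
    · exact Or.inl ⟨h.symm, h'.symm⟩
    · exact Or.inr ⟨h.symm, h'.symm⟩⟩
  loopless := ⟨by
    intro p h
    omega⟩

theorem isPlaneArc_segment {p q : ℝ × ℝ} (h : p ≠ q) : IsPlaneArc (segment ℝ p q) p q := by
  refine ⟨fun t => AffineMap.lineMap p q (t : ℝ), ?_, ?_, by simp, by simp, ?_⟩
  · exact (AffineMap.lineMap_continuous (R := ℝ) (p := p) (q := q)).comp continuous_subtype_val
  · exact (AffineMap.lineMap_injective ℝ h).comp Subtype.val_injective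
  · rw [segment_eq_image_lineMap]
    ext z
    constructor
    · rintro ⟨t, rfl⟩
      exact ⟨t, t.2, rfl⟩
    · rintro ⟨t, ht, rfl⟩
      exact ⟨⟨t, ht⟩, rfl⟩

theorem mem_segment_horizontal {a b y : ℝ} {z : ℝ × ℝ} (h : z ∈ segment ℝ (a, y) (b, y))
    (hab : a ≤ b) : z.2 = y ∧ a ≤ z.1 ∧ z.1 ≤ b := by
  rw [← Prod.image_mk_segment_left, segment_eq_Icc hab] at h
  obtain ⟨t, ht, rfl⟩ := h
  exact ⟨rfl, ht.1, ht.2⟩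

theorem mem_segment_vertical {a b x : ℝ} {z : ℝ × ℝ} (h : z ∈ segment ℝ (x, a) (x, b))
    (hab : a ≤ b) : z.1 = x ∧ a ≤ z.2 ∧ z.2 ≤ b := by
  rw [← Prod.image_mk_segment_right, segment_eq_Icc hab] at h
  obtain ⟨t, ht, rfl⟩ := h
  exact ⟨rfl, ht.1, ht.2⟩

/-- Every edge of the grid joins a point to its right or upper neighbour. -/
theorem gridGraph_edge_cases {w h : ℕ} {e : Sym2 (Fin (w + 1) × Fin (h + 1))}
    (he : e ∈ (gridGraph w h).edgeSet) :
    ∃ u v : Fin (w + 1) × Fin (h + 1), e = s(u, v) ∧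
      ((u.2 = v.2 ∧ (u.1 : ℕ) + 1 = v.1) ∨ (u.1 = v.1 ∧ (u.2 : ℕ) + 1 = v.2)) := by
  induction e using Sym2.ind with
  | _ u v =>
    rcases he with ⟨h1, h2 | h2⟩ | ⟨h1, h2 | h2⟩
    · exact ⟨u, v, rfl, Or.inl ⟨h1, h2⟩⟩
    · exact ⟨v, u, Sym2.eq_swap, Or.inl ⟨h1.symm, h2⟩⟩
    · exact ⟨u, v, rfl, Or.inr ⟨h1, h2⟩⟩
    · exact ⟨v, u, Sym2.eq_swap, Or.inr ⟨h1.symm, h2⟩⟩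

/-- Vertices sit at integer points and edges are unit segments. Two distinct such segments can meet
only in an integer point that is an end of both. -/
theorem isPlanarGraph_gridGraph (w h : ℕ) : IsPlanarGraph (gridGraph w h) := by
  let pt : Fin (w + 1) × Fin (h + 1) → ℝ × ℝ := fun p => ((p.1 : ℕ), (p.2 : ℕ))
  have hpt : Function.Injective pt := by
    rintro ⟨a, b⟩ ⟨c, d⟩ hh
    simpa [pt, Fin.ext_iff] using hh
  let arc : Sym2 (Fin (w + 1) × Fin (h + 1)) → Set (ℝ × ℝ) :=
    Sym2.lift ⟨fun u v => segment ℝ (pt u) (pt v), fun u v => segment_symm ℝ _ _⟩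
  have hmem : ∀ u v : Fin (w + 1) × Fin (h + 1), ∀ z, z ∈ arc s(u, v) →
      ((u.2 = v.2 ∧ (u.1 : ℕ) + 1 = v.1) → z.2 = (u.2 : ℕ) ∧ ((u.1 : ℕ) : ℝ) ≤ z.1 ∧
        z.1 ≤ (u.1 : ℕ) + 1) ∧
      ((u.1 = v.1 ∧ (u.2 : ℕ) + 1 = v.2) → z.1 = (u.1 : ℕ) ∧ ((u.2 : ℕ) : ℝ) ≤ z.2 ∧
        z.2 ≤ (u.2 : ℕ) + 1) := by
    rintro ⟨a, b⟩ ⟨c, d⟩ z hz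
    constructor
    · rintro ⟨rfl, h2⟩
      simp only [arc, pt, Sym2.lift_mk] at hz h2
      rw [← h2] at hz
      push_cast at hz
      exact mem_segment_horizontal hz (by linarith)
    · rintro ⟨rfl, h2⟩
      simp only [arc, pt, Sym2.lift_mk] at hz h2
      rw [← h2] at hz
      push_cast at hz
      exact mem_segment_vertical hz (by linarith)
  refine ⟨⟨pt, arc, hpt, ?_, ?_, ?_⟩⟩
  · intro u v huv
    exact isPlaneArc_segment (hpt.ne huv.ne)
  · intro e he p hp
    obtain ⟨u, v, rfl, huv⟩ := gridGraph_edge_cases he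
    have h1 := hmem u v _ hp
    rw [Sym2.mem_iff]
    rcases huv with huv | huv
    · obtain ⟨h2, h3, h4⟩ := h1.1 huv
      simp only [pt] at h2 h3 h4
      norm_cast at h2 h3 h4
      simp only [Prod.ext_iff, Fin.ext_iff] at huv ⊢
      omega
    · obtain ⟨h2, h3, h4⟩ := h1.2 huv
      simp only [pt] at h2 h3 h4
      norm_cast at h2 h3 h4
      simp only [Prod.ext_iff, Fin.ext_iff] at huv ⊢
      omega
  · intro e he f hf hef z hze hzf
    obtain ⟨u, v, rfl, huv⟩ := gridGraph_edge_cases he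
    obtain ⟨u', v', rfl, huv'⟩ := gridGraph_edge_cases hf
    have h1 := hmem u v _ hze
    have h1' := hmem u' v' _ hzf
    have key : ∀ p, p ∈ s(u, v) → p ∈ s(u', v') → z.1 = (p.1 : ℕ) → z.2 = (p.2 : ℕ) →
        ∃ w, w ∈ s(u, v) ∧ w ∈ s(u', v') ∧ z = pt w :=
      fun p hp hp' ha hb => ⟨p, hp, hp', Prod.ext ha hb⟩
    obtain ⟨⟨a, ha⟩, ⟨b, hb⟩⟩ := u
    obtain ⟨⟨c, hc⟩, ⟨d, hd⟩⟩ := v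
    obtain ⟨⟨a', ha'⟩, ⟨b', hb'⟩⟩ := u'
    obtain ⟨⟨c', hc'⟩, ⟨d', hd'⟩⟩ := v'
    obtain ⟨x, y⟩ := z
    simp only [Fin.mk.injEq] at h1 h1' huv huv'
    rcases huv with huv | huv <;> rcases huv' with huv' | huv'
    · obtain ⟨p1, p2, p3⟩ := h1.1 huv
      obtain ⟨q1, q2, q3⟩ := h1'.1 huv'
      obtain ⟨rfl, rfl⟩ := huv
      obtain ⟨rfl, rfl⟩ := huv'
      have e1 : b = b' := by exact_mod_cast p1.symm.trans q1
      subst e1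
      have e2 : a ≤ a' + 1 := by exact_mod_cast p2.trans q3
      have e3 : a' ≤ a + 1 := by exact_mod_cast q2.trans p3
      have e4 : a ≠ a' := by
        rintro rfl
        exact hef rfl
      have : a + 1 = a' ∨ a' + 1 = a := by omega
      rcases this with rfl | rfl
      · refine key (⟨a + 1, hc⟩, ⟨b, hb⟩) (by simp) (by simp) ?_ p1
        push_cast at q2 ⊢
        linarith
      · refine key (⟨a' + 1, ha⟩, ⟨b, hb⟩) (by simp) (by simp) ?_ p1
        push_cast at p2 ⊢
        linarith
    · obtain ⟨p1, p2, p3⟩ := h1.1 huv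
      obtain ⟨q1, q2, q3⟩ := h1'.2 huv'
      obtain ⟨rfl, rfl⟩ := huv
      obtain ⟨rfl, rfl⟩ := huv'
      rw [q1] at p2 p3
      rw [p1] at q2 q3
      norm_cast at p2 p3 q2 q3
      refine key (⟨a', ha'⟩, ⟨b, hb⟩) ?_ ?_ q1 p1
      · simp only [Sym2.mem_iff, Prod.mk.injEq, Fin.mk.injEq, and_true]
        omega
      · simp only [Sym2.mem_iff, Prod.mk.injEq, Fin.mk.injEq, true_and]
        omega
    · obtain ⟨p1, p2, p3⟩ := h1.2 huv
      obtain ⟨q1, q2, q3⟩ := h1'.1 huv'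
      obtain ⟨rfl, rfl⟩ := huv
      obtain ⟨rfl, rfl⟩ := huv'
      rw [q1] at p2 p3
      rw [p1] at q2 q3
      norm_cast at p2 p3 q2 q3
      refine key (⟨a, ha⟩, ⟨b', hb'⟩) ?_ ?_ p1 q1
      · simp only [Sym2.mem_iff, Prod.mk.injEq, Fin.mk.injEq, true_and]
        omega
      · simp only [Sym2.mem_iff, Prod.mk.injEq, Fin.mk.injEq, and_true]
        omega
    · obtain ⟨p1, p2, p3⟩ := h1.2 huv
      obtain ⟨q1, q2, q3⟩ := h1'.2 huv'
      obtain ⟨rfl, rfl⟩ := huv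
      obtain ⟨rfl, rfl⟩ := huv'
      have e1 : a = a' := by exact_mod_cast p1.symm.trans q1
      subst e1
      have e2 : b ≤ b' + 1 := by exact_mod_cast p2.trans q3
      have e3 : b' ≤ b + 1 := by exact_mod_cast q2.trans p3
      have e4 : b ≠ b' := by
        rintro rfl
        exact hef rfl
      have : b + 1 = b' ∨ b' + 1 = b := by omega
      rcases this with rfl | rfl
      · refine key (⟨a, ha⟩, ⟨b + 1, hd⟩) (by simp) (by simp) p1 ?_
        push_cast at q2 ⊢
        linarith
      · refine key (⟨a, ha⟩, ⟨b' + 1, hb⟩) (by simp) (by simp) p1 ?_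
        push_cast at p2 ⊢
        linarith

/-! ### Counting changes of side along a path -/

open Classical in
/-- The number of changes of the truth value of `f` along the interval from `s` to `t`. -/
noncomputable def jumps (f : ℕ → Prop) (s t : ℕ) : ℕ :=
  ((Finset.Ico s t).filter fun i => ¬(f i ↔ f (i + 1))).card

theorem iff_of_jumps_eq_zero {f : ℕ → Prop} {s t : ℕ} (hst : s ≤ t) (h : jumps f s t = 0) :
    f s ↔ f t := by
  classical
  rw [jumps, Finset.card_eq_zero, Finset.filter_eq_empty_iff] at h
  induction t, hst using Nat.le_induction with
  | base => rfl
  | succ t hst ih =>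
    rw [ih fun i hi => h (by simp only [Finset.mem_Ico] at hi ⊢; omega)]
    exact not_not.1 (h (Finset.mem_Ico.2 ⟨hst, t.lt_succ_self⟩))

theorem jumps_eq_zero_of_le {f : ℕ → Prop} {s t t' : ℕ} (h : jumps f s t = 0) (ht : t' ≤ t) :
    jumps f s t' = 0 := by
  classical
  rw [jumps, Finset.card_eq_zero, Finset.filter_eq_empty_iff] at h ⊢
  intro i hi
  exact h (by simp only [Finset.mem_Ico] at hi ⊢; omega)

/-- The truth value is constant on each side of the threshold, so the only possible change is
between `T` and `T + 1`. -/
theorem jumps_le_of_threshold {f : ℕ → Prop} {s t T : ℕ} {P Q : Prop} [Decidable P] [Decidable Q]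
    (hP : ∀ i, s ≤ i → i ≤ t → i ≤ T → (f i ↔ P))
    (hQ : ∀ i, s ≤ i → i ≤ t → T < i → (f i ↔ Q)) :
    jumps f s t ≤ if s ≤ T ∧ T < t ∧ ¬(P ↔ Q) then 1 else 0 := by
  classical
  have h : (Finset.Ico s t).filter (fun i => ¬(f i ↔ f (i + 1))) ⊆
      if s ≤ T ∧ T < t ∧ ¬(P ↔ Q) then {T} else ∅ := by
    intro i hi
    simp only [Finset.mem_filter, Finset.mem_Ico] at hi
    obtain ⟨⟨h1, h2⟩, h3⟩ := hi
    rcases lt_trichotomy i T with h | rfl | h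
    · exact absurd ((hP i h1 h2.le h.le).trans (hP (i + 1) (by omega) h2 h).symm) h3
    · rw [hP i h1 h2.le le_rfl, hQ (i + 1) (by omega) h2 (by omega)] at h3
      rw [if_pos ⟨h1, h2, h3⟩]
      exact Finset.mem_singleton_self i
    · exact absurd ((hQ i h1 h2.le h).trans (hQ (i + 1) (by omega) h2 (by omega)).symm) h3
  have hc := Finset.card_le_card h
  rw [jumps]
  convert hc.trans ?_ using 1
  split_ifs <;> simp

theorem exists_threshold_of_jumps_le_one {f : ℕ → Prop} {s t : ℕ} (hst : s ≤ t) (hs : f s)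
    (ht : ¬f t) (h : jumps f s t ≤ 1) :
    ∃ j, s ≤ j ∧ j < t ∧ (∀ y, s ≤ y → y ≤ t → (f y ↔ y ≤ j)) := by
  classical
  have h0 : jumps f s t ≠ 0 := fun h0 => ht ((iff_of_jumps_eq_zero hst h0).1 hs)
  obtain ⟨j, hj⟩ := Finset.card_eq_one.1 (show jumps f s t = 1 by omega)
  have hjm : j ∈ (Finset.Ico s t).filter fun i => ¬(f i ↔ f (i + 1)) := by simp [hj]
  simp only [Finset.mem_filter, Finset.mem_Ico] at hjm
  have hz : ∀ s' t', s ≤ s' → t' ≤ t → (t' ≤ j ∨ j < s') → jumps f s' t' = 0 := by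
    intro s' t' h1 h2 h3
    rw [jumps, Finset.card_eq_zero, Finset.filter_eq_empty_iff]
    intro i hi hfi
    have : i ∈ (Finset.Ico s t).filter fun i => ¬(f i ↔ f (i + 1)) := by
      simp only [Finset.mem_filter, Finset.mem_Ico] at hi ⊢
      exact ⟨by omega, hfi⟩
    rw [hj, Finset.mem_singleton] at this
    simp only [Finset.mem_Ico] at hi
    omega
  refine ⟨j, hjm.1.1, hjm.1.2, fun y h1 h2 => ⟨fun hy => ?_, fun hy => ?_⟩⟩
  · by_contra hyj
    exact ht ((iff_of_jumps_eq_zero h2 (hz y t h1 le_rfl (by omega))).1 hy)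
  · exact (iff_of_jumps_eq_zero h1 (hz s y le_rfl h2 (by omega))).1 hs

/-! ### Lexicographic comparison of digits -/

/-- Let `g` be the digits of a number in base `b + 1`, highest first. If a number with digits `f`
is at most as large, and each `f i` is at least `g i` as soon as all higher digits agree, then the
two digit sequences are equal. -/
theorem eq_of_digits_le {b d : ℕ} {f g : ℕ → ℕ} (hg : ∀ i < d, g i ≤ b)
    (hfg : ∀ i < d, (∀ l < i, f l = g l) → g i ≤ f i)
    (hle : ∑ i ∈ Finset.range d, (b + 1) ^ (d - 1 - i) * f i ≤
      ∑ i ∈ Finset.range d, (b + 1) ^ (d - 1 - i) * g i) :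
    (∑ i ∈ Finset.range d, (b + 1) ^ (d - 1 - i) * g i < (b + 1) ^ d) ∧ ∀ i < d, f i = g i := by
  induction d generalizing f g with
  | zero => simp
  | succ d ih =>
    have hexp : ∀ i, d + 1 - 1 - (i + 1) = d - 1 - i := by omega
    simp only [Finset.sum_range_succ', hexp] at hle ⊢
    simp only [Nat.add_sub_cancel, Nat.sub_zero] at hle ⊢
    -- Comparing the lower digits of `g` with themselves yields only the size bound, which rules out
    -- a larger leading digit of `f`.
    have hlt := (ih (f := fun i => g (i + 1)) (g := fun i => g (i + 1))
      (fun i hi => hg _ (by omega)) (fun _ _ _ => le_rfl) le_rfl).1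
    have h0 : g 0 ≤ f 0 := hfg 0 (by omega) (by omega)
    have hf0 : f 0 = g 0 := by
      by_contra hne
      have : (b + 1) ^ d * (g 0 + 1) ≤ (b + 1) ^ d * f 0 := Nat.mul_le_mul_left _ (by omega)
      rw [mul_add, mul_one] at this
      omega
    rw [hf0] at hle
    have h2 := ih (f := fun i => f (i + 1)) (g := fun i => g (i + 1))
      (fun i hi => hg _ (by omega)) (fun i hi hl => hfg (i + 1) (by omega) fun l hl' => by
        cases l with
        | zero => exact hf0
        | succ l => exact hl l (by omega)) (by omega)
    refine ⟨?_, fun i hi => ?_⟩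
    · have : (b + 1) ^ d * g 0 ≤ (b + 1) ^ d * b := Nat.mul_le_mul_left _ (hg 0 (by omega))
      rw [pow_succ, mul_add, mul_one]
      omega
    · cases i with
      | zero => exact hf0
      | succ i => exact h2.2 i (by omega)

/-! ### A single strip -/

/-- The number of the lines of a strip, joining row `2 * b` to row `b` or row `2 * b` to row
`b + n`, that are crossed when the strip is entered below row `j` and left below row `j'`. -/
def stripCost (n j j' : ℕ) : ℕ :=
  ∑ b ∈ Finset.Ico 1 n, ((if (2 * b ≤ j ↔ b ≤ j') then 0 else 1) +
    (if (2 * b ≤ j ↔ b + n ≤ j') then 0 else 1))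

theorem stripCost_le (n j j' : ℕ) : stripCost n j j' ≤ 2 * n := by
  have h : stripCost n j j' ≤ ∑ b ∈ Finset.Ico 1 n, 2 := by
    refine Finset.sum_le_sum fun b _ => ?_
    split_ifs <;> omega
  simp only [Finset.sum_const, Nat.card_Ico, smul_eq_mul] at h
  omega

/-- Since `1 ≤ b < n`, one family of lines has all its right ends on a side determined by whether `n
≤ j₁`, so it costs the same for `j₁` and `j₂`. The shifted height makes the other family free,
because `2 * b ≤ j` iff `b ≤ j / 2`. -/
theorem stripCost_le_of_shift {n j j₁ j₂ : ℕ} (hj : j < 2 * n) (hj₁ : j₁ < 2 * n)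
    (hj₂ : j₂ < 2 * n) (hs : j₁ = (if n ≤ j₁ then n else 0) + j / 2) (h : n ≤ j₁ ↔ n ≤ j₂) :
    stripCost n j j₁ ≤ stripCost n j j₂ ∧ (stripCost n j j₂ = stripCost n j j₁ → j₂ = j₁) := by
  have hle : ∀ b ∈ Finset.Ico 1 n, ((if (2 * b ≤ j ↔ b ≤ j₁) then 0 else 1) +
      (if (2 * b ≤ j ↔ b + n ≤ j₁) then 0 else 1)) ≤
      ((if (2 * b ≤ j ↔ b ≤ j₂) then 0 else 1) + (if (2 * b ≤ j ↔ b + n ≤ j₂) then 0 else 1)) := by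
    intro b hb
    rw [Finset.mem_Ico] at hb
    split_ifs at * <;> omega
  refine ⟨Finset.sum_le_sum hle, fun heq => ?_⟩
  by_contra hne
  -- The line ending at the larger of the two heights, taken modulo `n`, is cut for `j₂` but not for
  -- `j₁`.
  refine heq.not_gt (Finset.sum_lt_sum hle ⟨max (j₁ % n) (j₂ % n), ?_⟩)
  by_cases hn : n ≤ j₁
  · have e1 : j₁ % n = j₁ - n := by rw [Nat.mod_eq_sub_mod hn, Nat.mod_eq_of_lt (by omega)]
    have e2 : j₂ % n = j₂ - n := by
      rw [Nat.mod_eq_sub_mod (h.1 hn), Nat.mod_eq_of_lt (by omega)]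
    rw [e1, e2, Finset.mem_Ico]
    rw [if_pos hn] at hs
    rcases max_cases (j₁ - n) (j₂ - n) with ⟨hm, _⟩ | ⟨hm, _⟩ <;> rw [hm] <;>
      refine ⟨by omega, ?_⟩ <;> split_ifs <;> omega
  · have e1 : j₁ % n = j₁ := Nat.mod_eq_of_lt (by omega)
    have e2 : j₂ % n = j₂ := Nat.mod_eq_of_lt (by omega)
    rw [e1, e2, Finset.mem_Ico]
    rw [if_neg hn] at hs
    rcases max_cases j₁ j₂ with ⟨hm, _⟩ | ⟨hm, _⟩ <;> rw [hm] <;>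
      refine ⟨by omega, ?_⟩ <;> split_ifs <;> omega

/-- The number of changes of `χ` along the path that goes horizontally from `(x, 2 * b)`, then
vertically in column `x + b`, then horizontally to `(x + n, b)`. -/
noncomputable def risingJumps (χ : ℕ → ℕ → Prop) (n x b : ℕ) : ℕ :=
  jumps (fun s => χ s (2 * b)) x (x + b) + jumps (χ (x + b)) b (2 * b) +
    jumps (fun s => χ s b) (x + b) (x + n)

/-- The number of changes of `χ` along the path that goes horizontally from `(x, 2 * b)`, then
vertically in column `x + (n - b)`, then horizontally to `(x + n, b + n)`. -/
noncomputable def fallingJumps (χ : ℕ → ℕ → Prop) (n x b : ℕ) : ℕ :=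
  jumps (fun s => χ s (2 * b)) x (x + (n - b)) + jumps (χ (x + (n - b))) (2 * b) (b + n) +
    jumps (fun s => χ s (b + n)) (x + (n - b)) (x + n)

noncomputable def stripJumps (χ : ℕ → ℕ → Prop) (n x : ℕ) : ℕ :=
  ∑ b ∈ Finset.Ico 1 n, (risingJumps χ n x b + fallingJumps χ n x b)

/-- A path whose ends lie on different sides changes side at least once. -/
theorem stripCost_le_stripJumps {χ : ℕ → ℕ → Prop} {n x j j' : ℕ}
    (hj : ∀ y ≤ 2 * n, (χ x y ↔ y ≤ j)) (hj' : ∀ y ≤ 2 * n, (χ (x + n) y ↔ y ≤ j')) :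
    stripCost n j j' ≤ stripJumps χ n x := by
  refine Finset.sum_le_sum fun b hb => ?_
  rw [Finset.mem_Ico] at hb
  refine add_le_add ?_ ?_
  · split_ifs with h
    · exact Nat.zero_le _
    · by_contra hlt
      have h0 : risingJumps χ n x b = 0 := by omega
      simp only [risingJumps, Nat.add_eq_zero_iff] at h0
      have h1 := iff_of_jumps_eq_zero (by omega) h0.1.1
      have h2 := iff_of_jumps_eq_zero (by omega) h0.1.2
      have h3 := iff_of_jumps_eq_zero (by omega) h0.2
      exact h (((hj _ (by omega)).symm.trans (h1.trans (h2.symm.trans h3))).trans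
        (hj' _ (by omega)))
  · split_ifs with h
    · exact Nat.zero_le _
    · by_contra hlt
      have h0 : fallingJumps χ n x b = 0 := by omega
      simp only [fallingJumps, Nat.add_eq_zero_iff] at h0
      have h1 := iff_of_jumps_eq_zero (by omega) h0.1.1
      have h2 := iff_of_jumps_eq_zero (by omega) h0.1.2
      have h3 := iff_of_jumps_eq_zero (by omega) h0.2
      exact h (((hj _ (by omega)).symm.trans (h1.trans (h2.trans h3))).trans
        (hj' _ (by omega)))

/-- The offset of the column at which the optimal cut through a strip changes its height. -/
def stepOffset (n j j' : ℕ) : ℕ :=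
  if n ≤ j' then n - 1 - j / 2 else j / 2

/-- In the family that should stay uncut, the step of the cut separates the turning columns of lines
with `2 * b ≤ j` from those with `2 * b > j`, so no line there is crossed. In the other family a
line is crossed at most once, and only if its ends are separated. -/
theorem stripJumps_le_stripCost {χ : ℕ → ℕ → Prop} {n x j j' : ℕ} (hjn : j < 2 * n)
    (hs : j' = (if n ≤ j' then n else 0) + j / 2)
    (h1 : ∀ s ≤ stepOffset n j j', ∀ y ≤ 2 * n, (χ (x + s) y ↔ y ≤ j))
    (h2 : ∀ s ≤ n, stepOffset n j j' < s → ∀ y ≤ 2 * n, (χ (x + s) y ↔ y ≤ j')) :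
    stripJumps χ n x ≤ stripCost n j j' := by
  have hhor : ∀ y ≤ 2 * n, ∀ s t, t ≤ n → jumps (fun s => χ s y) (x + s) (x + t) ≤
      if s ≤ stepOffset n j j' ∧ stepOffset n j j' < t ∧ ¬(y ≤ j ↔ y ≤ j') then 1 else 0 := by
    intro y hy s t ht
    refine (jumps_le_of_threshold (T := x + stepOffset n j j') (P := y ≤ j) (Q := y ≤ j')
      ?_ ?_).trans_eq ?_
    · intro i hi _ hiT
      obtain ⟨u, rfl⟩ := Nat.exists_eq_add_of_le (show x ≤ i by omega)
      exact h1 u (by omega) y hy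
    · intro i _ hit hiT
      obtain ⟨u, rfl⟩ := Nat.exists_eq_add_of_le (show x ≤ i by omega)
      exact h2 u (by omega) (by omega) y hy
    · simp only [add_le_add_iff_left, add_lt_add_iff_left]
  have hver : ∀ s ≤ n, ∀ u v, v ≤ 2 * n → jumps (χ (x + s)) u v ≤
      if s ≤ stepOffset n j j' then (if u ≤ j ∧ j < v then 1 else 0)
      else (if u ≤ j' ∧ j' < v then 1 else 0) := by
    intro s hsn u v hv
    by_cases hsT : s ≤ stepOffset n j j'
    · rw [if_pos hsT]
      refine (jumps_le_of_threshold (T := j) (P := True) (Q := False) ?_ ?_).trans_eq (by simp)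
      · intro i _ hi hij
        simp [h1 s hsT i (by omega), hij]
      · intro i _ hi hij
        simp [h1 s hsT i (by omega), hij]
    · rw [if_neg hsT]
      refine (jumps_le_of_threshold (T := j') (P := True) (Q := False) ?_ ?_).trans_eq (by simp)
      · intro i _ hi hij
        simp [h2 s hsn (by omega) i (by omega), hij]
      · intro i _ hi hij
        simp [h2 s hsn (by omega) i (by omega), hij]
  refine Finset.sum_le_sum fun b hb => ?_
  rw [Finset.mem_Ico] at hb
  refine add_le_add ?_ ?_
  · have e1 := hhor (2 * b) (by omega) 0 b (by omega)
    have e2 := hver b (by omega) b (2 * b) (by omega)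
    have e3 := hhor b (by omega) b n le_rfl
    rw [add_zero] at e1
    refine (add_le_add (add_le_add e1 e2) e3).trans ?_
    clear e1 e2 e3 hhor hver h1 h2
    unfold stepOffset
    by_cases hn : n ≤ j'
    · simp only [if_pos hn] at hs ⊢
      split_ifs <;> omega
    · simp only [if_neg hn] at hs ⊢
      split_ifs <;> omega
  · have e1 := hhor (2 * b) (by omega) 0 (n - b) (by omega)
    have e2 := hver (n - b) (by omega) (2 * b) (b + n) (by omega)
    have e3 := hhor (b + n) (by omega) (n - b) n le_rfl
    rw [add_zero] at e1
    refine (add_le_add (add_le_add e1 e2) e3).trans ?_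
    clear e1 e2 e3 hhor hver h1 h2
    unfold stepOffset
    by_cases hn : n ≤ j'
    · simp only [if_pos hn] at hs ⊢
      split_ifs <;> omega
    · simp only [if_neg hn] at hs ⊢
      split_ifs <;> omega

/-! ### Optimal cuts of the whole grid -/

/-- The cost of the set `χ` of points of the grid with columns `0, …, d * 2 ^ d` and rows
`0, …, 2 * 2 ^ d`. -/
noncomputable def gridCost (d : ℕ) (χ : ℕ → ℕ → Prop) : ℕ :=
  (d + 2) * (2 * 2 ^ d + 1) ^ d *
      (jumps (fun x => χ x 0) 0 (d * 2 ^ d) + jumps (fun x => χ x (2 * 2 ^ d)) 0 (d * 2 ^ d)) +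
    (2 * 2 ^ d + 1) ^ d * ∑ i ∈ Finset.range (d + 1), jumps (χ (i * 2 ^ d)) 0 (2 * 2 ^ d) +
    (2 * 2 ^ d + 1) ^ d * (jumps (χ 0) 1 (2 ^ d) + jumps (χ 0) (2 ^ d + 1) (2 * 2 ^ d)) +
    ∑ i ∈ Finset.range d, (2 * 2 ^ d + 1) ^ (d - 1 - i) * stripJumps χ (2 ^ d) (i * 2 ^ d)

/-- The heights at which an optimal cut passes the columns that contain a terminal: at each
column, the height is halved and the highest bit is replaced by a new one. -/
structure IsShiftSequence (d : ℕ) (J : ℕ → ℕ) : Prop where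
  lt : ∀ i ≤ d, J i < 2 * 2 ^ d
  zero : J 0 = 0 ∨ J 0 = 2 ^ d
  succ : ∀ i < d, J (i + 1) = (if 2 ^ d ≤ J (i + 1) then 2 ^ d else 0) + J i / 2

/-- The height of an optimal cut in column `x`. -/
def cutHeight (d : ℕ) (J : ℕ → ℕ) (x : ℕ) : ℕ :=
  if x % 2 ^ d ≤ stepOffset (2 ^ d) (J (x / 2 ^ d)) (J (x / 2 ^ d + 1)) then J (x / 2 ^ d)
  else J (x / 2 ^ d + 1)

section

variable {d : ℕ} {J : ℕ → ℕ}

theorem cutHeight_mul (d : ℕ) (J : ℕ → ℕ) (i : ℕ) : cutHeight d J (i * 2 ^ d) = J i := by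
  simp [cutHeight]

theorem cutHeight_of_le {i s : ℕ} (hJ : IsShiftSequence d J) (hi : i < d)
    (hs : s ≤ stepOffset (2 ^ d) (J i) (J (i + 1))) : cutHeight d J (i * 2 ^ d + s) = J i := by
  have hlt : s < 2 ^ d := by
    have h1 := hJ.lt i hi.le
    have h2 : 0 < 2 ^ d := by positivity
    unfold stepOffset at hs
    split_ifs at hs <;> omega
  have e1 : (i * 2 ^ d + s) / 2 ^ d = i := by
    rw [mul_comm, Nat.mul_add_div (by positivity), Nat.div_eq_of_lt hlt, add_zero]
  have e2 : (i * 2 ^ d + s) % 2 ^ d = s := by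
    rw [mul_comm, Nat.mul_add_mod, Nat.mod_eq_of_lt hlt]
  rw [cutHeight, e1, e2, if_pos hs]

theorem cutHeight_of_lt {i s : ℕ} (hsn : s ≤ 2 ^ d)
    (hs : stepOffset (2 ^ d) (J i) (J (i + 1)) < s) :
    cutHeight d J (i * 2 ^ d + s) = J (i + 1) := by
  rcases hsn.eq_or_lt with rfl | hlt
  · rw [← Nat.succ_mul, cutHeight_mul]
  have e1 : (i * 2 ^ d + s) / 2 ^ d = i := by
    rw [mul_comm, Nat.mul_add_div (by positivity), Nat.div_eq_of_lt hlt, add_zero]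
  have e2 : (i * 2 ^ d + s) % 2 ^ d = s := by
    rw [mul_comm, Nat.mul_add_mod, Nat.mod_eq_of_lt hlt]
  rw [cutHeight, e1, e2, if_neg (by omega)]

theorem cutHeight_lt (hJ : IsShiftSequence d J) {x : ℕ} (hx : x ≤ d * 2 ^ d) :
    cutHeight d J x < 2 * 2 ^ d := by
  rcases hx.eq_or_lt with rfl | hx
  · rw [cutHeight_mul]
    exact hJ.lt d le_rfl
  · have : x / 2 ^ d < d := Nat.div_lt_of_lt_mul (by rwa [mul_comm])
    unfold cutHeight
    split_ifs
    · exact hJ.lt _ (by omega)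
    · exact hJ.lt _ (by omega)

/-- The explicit cut avoids the top and bottom rows and crosses each terminal column once. In column
0 it uses one of the two edges without surcharge, leaving row 0 or row `2 ^ d`. -/
theorem gridCost_le (hJ : IsShiftSequence d J) {χ : ℕ → ℕ → Prop}
    (hχ : ∀ x ≤ d * 2 ^ d, ∀ y ≤ 2 * 2 ^ d, (χ x y ↔ y ≤ cutHeight d J x)) :
    gridCost d χ ≤ (d + 1) * (2 * 2 ^ d + 1) ^ d +
      ∑ i ∈ Finset.range d, (2 * 2 ^ d + 1) ^ (d - 1 - i) *
        stripCost (2 ^ d) (J i) (J (i + 1)) := by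
  have hW : ∀ i ≤ d, i * 2 ^ d ≤ d * 2 ^ d := fun i hi => Nat.mul_le_mul_right _ hi
  have r1 : jumps (fun x => χ x 0) 0 (d * 2 ^ d) = 0 := by
    refine Nat.le_zero.1 ((jumps_le_of_threshold (T := d * 2 ^ d) (P := True) (Q := True)
      ?_ ?_).trans_eq (by simp))
    · intro i _ hi _
      simp [hχ i hi 0 (by omega)]
    · intros
      omega
  have r2 : jumps (fun x => χ x (2 * 2 ^ d)) 0 (d * 2 ^ d) = 0 := by
    refine Nat.le_zero.1 ((jumps_le_of_threshold (T := d * 2 ^ d) (P := False) (Q := False)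
      ?_ ?_).trans_eq (by simp))
    · intro i _ hi _
      have := cutHeight_lt hJ hi
      rw [hχ i hi _ le_rfl]
      simp only [iff_false]
      omega
    · intros
      omega
  have hcol : ∀ i ≤ d, ∀ u v, v ≤ 2 * 2 ^ d → jumps (χ (i * 2 ^ d)) u v ≤
      if u ≤ J i ∧ J i < v then 1 else 0 := by
    intro i hi u v hv
    refine (jumps_le_of_threshold (T := J i) (P := True) (Q := False) ?_ ?_).trans_eq (by simp)
    · intro y _ hy hyj
      rw [hχ _ (hW i hi) y (by omega), cutHeight_mul]
      simp [hyj]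
    · intro y _ hy hyj
      rw [hχ _ (hW i hi) y (by omega), cutHeight_mul]
      simp [hyj]
  have c1 : ∑ i ∈ Finset.range (d + 1), jumps (χ (i * 2 ^ d)) 0 (2 * 2 ^ d) ≤ d + 1 := by
    refine (Finset.sum_le_card_nsmul _ _ 1 fun i hi => ?_).trans_eq (by simp)
    refine (hcol i (by simpa [Nat.lt_succ_iff] using hi) _ _ le_rfl).trans ?_
    split_ifs <;> omega
  have c2 : jumps (χ 0) 1 (2 ^ d) = 0 := by
    have := hcol 0 (Nat.zero_le _) 1 (2 ^ d) (by omega)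
    rw [zero_mul, if_neg (by rcases hJ.zero with h | h <;> omega)] at this
    omega
  have c3 : jumps (χ 0) (2 ^ d + 1) (2 * 2 ^ d) = 0 := by
    have := hcol 0 (Nat.zero_le _) (2 ^ d + 1) (2 * 2 ^ d) (by omega)
    rw [zero_mul, if_neg (by rcases hJ.zero with h | h <;> omega)] at this
    omega
  rw [gridCost, r1, r2, c2, c3, mul_comm (d + 1)]
  simp only [add_zero, mul_zero, zero_add]
  refine add_le_add (Nat.mul_le_mul_left _ c1) (Finset.sum_le_sum fun i hi => ?_)
  rw [Finset.mem_range] at hi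
  have hstrip : i * 2 ^ d + 2 ^ d ≤ d * 2 ^ d := by
    rw [← Nat.succ_mul]
    exact hW _ hi
  refine Nat.mul_le_mul_left _ (stripJumps_le_stripCost (hJ.lt i hi.le) (hJ.succ i hi) ?_ ?_)
  · intro s hs y hy
    have hsn : s ≤ 2 ^ d := by
      have h1 := hJ.lt i hi.le
      unfold stepOffset at hs
      split_ifs at hs <;> omega
    rw [hχ _ (by omega) y hy, cutHeight_of_le hJ hi hs]
  · intro s hsn hs y hy
    rw [hχ _ (by omega) y hy, cutHeight_of_lt hsn hs]

/-- Every set of at most the optimal cost passes the last column at the optimal height. -/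
theorem iff_le_of_gridCost_le (hJ : IsShiftSequence d J) {χ : ℕ → ℕ → Prop} (htop : χ 0 0)
    (hbot : ¬χ 0 (2 * 2 ^ d)) (hterm : ∀ i ≤ d, χ (i * 2 ^ d) (2 ^ d) ↔ 2 ^ d ≤ J i)
    (hle : gridCost d χ ≤ (d + 1) * (2 * 2 ^ d + 1) ^ d +
      ∑ i ∈ Finset.range d, (2 * 2 ^ d + 1) ^ (d - 1 - i) * stripCost (2 ^ d) (J i) (J (i + 1))) :
    ∀ y ≤ 2 * 2 ^ d, (χ (d * 2 ^ d) y ↔ y ≤ J d) := by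
  set n := 2 ^ d with hn
  have hnpos : 0 < n := by positivity
  set B := (2 * n + 1) ^ d with hB
  have hBpos : 0 < B := by positivity
  have hlt := (eq_of_digits_le (b := 2 * n) (d := d)
    (f := fun i => stripCost n (J i) (J (i + 1))) (g := fun i => stripCost n (J i) (J (i + 1)))
    (fun i _ => stripCost_le _ _ _) (fun _ _ _ => le_rfl) le_rfl).1
  have hle2 : gridCost d χ < (d + 2) * B := by
    rw [show (d + 2) * B = (d + 1) * B + B by ring]
    omega
  set R := jumps (fun x => χ x 0) 0 (d * n) + jumps (fun x => χ x (2 * n)) 0 (d * n) with hR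
  set C := ∑ i ∈ Finset.range (d + 1), jumps (χ (i * n)) 0 (2 * n) with hC
  set Z := jumps (χ 0) 1 n + jumps (χ 0) (n + 1) (2 * n) with hZ
  have hgc : gridCost d χ = (d + 2) * B * R + B * C + B * Z +
    ∑ i ∈ Finset.range d, (2 * n + 1) ^ (d - 1 - i) * stripJumps χ n (i * n) := rfl
  -- The strip terms of the optimum total less than `B`, so the budget is below `(d + 2) * B`, the
  -- price of one crossing of an outer row.
  have hR0 : R = 0 := by
    by_contra h
    have : (d + 2) * B * 1 ≤ (d + 2) * B * R := Nat.mul_le_mul_left _ (by omega)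
    omega
  have hrow : ∀ i ≤ d, χ (i * n) 0 ∧ ¬χ (i * n) (2 * n) := by
    intro i hi
    have hW : i * n ≤ d * n := Nat.mul_le_mul_right _ hi
    have h1 := iff_of_jumps_eq_zero (Nat.zero_le _)
      (jumps_eq_zero_of_le (show jumps (fun x => χ x 0) 0 (d * n) = 0 by omega) hW)
    have h2 := iff_of_jumps_eq_zero (Nat.zero_le _)
      (jumps_eq_zero_of_le (show jumps (fun x => χ x (2 * n)) 0 (d * n) = 0 by omega) hW)
    exact ⟨h1.1 htop, fun h => hbot (h2.2 h)⟩
  have hcol1 : ∀ i ≤ d, 1 ≤ jumps (χ (i * n)) 0 (2 * n) := by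
    intro i hi
    by_contra h
    exact (hrow i hi).2 ((iff_of_jumps_eq_zero (Nat.zero_le _) (by omega)).1 (hrow i hi).1)
  have hCge : d + 1 ≤ C := by
    refine le_trans (by simp) (Finset.card_nsmul_le_sum (Finset.range (d + 1)) _ 1 fun i hi => ?_)
    exact hcol1 i (by simpa [Nat.lt_succ_iff] using hi)
  -- Each column crossing and each surcharge costs `B`. As `d + 1` crossings are unavoidable, no
  -- further one and no surcharge is affordable.
  have hCZ : C + Z < d + 2 := by
    by_contra h
    have : B * (d + 2) ≤ B * (C + Z) := Nat.mul_le_mul_left _ (by omega)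
    rw [mul_add B C Z, mul_comm] at this
    omega
  have hCeq : C = d + 1 := by omega
  have hZ0 : Z = 0 := by omega
  have hcole : ∀ i ≤ d, jumps (χ (i * n)) 0 (2 * n) ≤ 1 := by
    intro i hi
    by_contra h
    have : ∑ i ∈ Finset.range (d + 1), 1 < C :=
      Finset.sum_lt_sum (fun i hi => hcol1 i (by simpa [Nat.lt_succ_iff] using hi))
        ⟨i, by simpa [Nat.lt_succ_iff] using hi, by omega⟩
    simp only [Finset.sum_const, Finset.card_range, smul_eq_mul, mul_one] at this
    omega
  have hex : ∀ i, ∃ j, i ≤ d → j < 2 * n ∧ ∀ y ≤ 2 * n, (χ (i * n) y ↔ y ≤ j) := by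
    intro i
    by_cases hi : i ≤ d
    · obtain ⟨j, -, hj, h⟩ := exists_threshold_of_jumps_le_one (Nat.zero_le _) (hrow i hi).1
        (hrow i hi).2 (hcole i hi)
      exact ⟨j, fun _ => ⟨hj, fun y hy => h y (Nat.zero_le _) hy⟩⟩
    · exact ⟨0, fun h => absurd h hi⟩
  choose j hj using hex
  have hhalf : ∀ i ≤ d, (n ≤ J i ↔ n ≤ j i) := fun i hi =>
    (hterm i hi).symm.trans ((hj i hi).2 n (by omega))
  -- Only the edges below rows 0 and `n` of column 0 carry no surcharge; the middle terminal decides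
  -- between them.
  have hj0 : j 0 = J 0 := by
    have h0 := (hj 0 (Nat.zero_le _))
    have hh := hhalf 0 (Nat.zero_le _)
    rw [zero_mul] at h0
    have z1 := iff_of_jumps_eq_zero (by omega) (show jumps (χ 0) 1 n = 0 by omega)
    have z2 := iff_of_jumps_eq_zero (by omega)
      (show jumps (χ 0) (n + 1) (2 * n) = 0 by omega)
    rw [h0.2 _ (by omega), h0.2 _ (by omega)] at z1 z2
    rcases hJ.zero with h | h <;> rw [h] at hh ⊢ <;> omega
  have hshift : ∀ i < d, j i = J i →
      stripCost n (J i) (J (i + 1)) ≤ stripCost n (j i) (j (i + 1)) ∧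
      (stripCost n (j i) (j (i + 1)) = stripCost n (J i) (J (i + 1)) → j (i + 1) = J (i + 1)) := by
    intro i hi hji
    rw [hji]
    exact stripCost_le_of_shift (hJ.lt i hi.le) (hJ.lt _ hi) (hj _ hi).1 (hJ.succ i hi) (hhalf _ hi)
  have hprop : ∀ i ≤ d, (∀ l < i, stripCost n (j l) (j (l + 1)) = stripCost n (J l) (J (l + 1))) →
      j i = J i := by
    intro i
    induction i with
    | zero => exact fun _ _ => hj0
    | succ i ih =>
      intro hi hl
      exact (hshift i hi (ih (by omega) fun l hli => hl l (by omega))).2 (hl i (by omega))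
  have hsum : ∑ i ∈ Finset.range d, (2 * n + 1) ^ (d - 1 - i) * stripCost n (j i) (j (i + 1)) ≤
      ∑ i ∈ Finset.range d, (2 * n + 1) ^ (d - 1 - i) * stripCost n (J i) (J (i + 1)) := by
    have hs : ∑ i ∈ Finset.range d, (2 * n + 1) ^ (d - 1 - i) * stripCost n (j i) (j (i + 1)) ≤
        ∑ i ∈ Finset.range d, (2 * n + 1) ^ (d - 1 - i) * stripJumps χ n (i * n) := by
      refine Finset.sum_le_sum fun i hi => ?_
      rw [Finset.mem_range] at hi
      refine Nat.mul_le_mul_left _ (stripCost_le_stripJumps (hj i hi.le).2 ?_)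
      have := (hj (i + 1) hi).2
      rwa [Nat.succ_mul i] at this
    rw [hgc, hR0, hZ0, hCeq, mul_comm B (d + 1)] at hle
    omega
  -- Greedy choice: once all earlier strip costs agree, so do the heights up to column `i`, and the
  -- next strip cannot be cheaper than the shift.
  have heq := (eq_of_digits_le (b := 2 * n) (d := d)
    (f := fun i => stripCost n (j i) (j (i + 1))) (g := fun i => stripCost n (J i) (J (i + 1)))
    (fun i _ => stripCost_le _ _ _) (fun i hi hl => (hshift i hi (hprop i hi.le hl)).1) hsum).2
  rw [← hprop d le_rfl heq]
  exact (hj d le_rfl).2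

/-- The bits of `F` enter at the top position, lowest bit first, one per terminal column; after `d +
1` entries the height is `F` itself. -/
theorem isShiftSequence_mod (d F : ℕ) :
    IsShiftSequence d fun i => F % 2 ^ (i + 1) * 2 ^ (d - i) where
  lt i hi := by
    have h1 : F % 2 ^ (i + 1) < 2 ^ (i + 1) := Nat.mod_lt _ (by positivity)
    have h2 : 2 ^ (i + 1) * 2 ^ (d - i) = 2 * 2 ^ d := by
      rw [← pow_add, show i + 1 + (d - i) = d + 1 by omega, pow_succ, mul_comm]
    rw [← h2]
    exact Nat.mul_lt_mul_of_pos_right h1 (by positivity)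
  zero := by
    rcases Nat.mod_two_eq_zero_or_one F with h | h <;> simp [h]
  succ i hi := by
    obtain ⟨e, rfl⟩ := Nat.exists_eq_add_of_lt hi
    simp only [show i + e + 1 - (i + 1) = e by omega, show i + e + 1 - i = e + 1 by omega]
    have h1 : F % 2 ^ (i + 1) * 2 ^ (e + 1) / 2 = F % 2 ^ (i + 1) * 2 ^ e := by
      rw [pow_succ 2 e, ← mul_assoc, Nat.mul_div_cancel _ (by norm_num)]
    have h2 : F % 2 ^ (i + 1 + 1) = F % 2 ^ (i + 1) + 2 ^ (i + 1) * (F / 2 ^ (i + 1) % 2) := by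
      rw [pow_succ, Nat.mod_mul]
    have h3 : (2 : ℕ) ^ (i + e + 1) = 2 ^ (i + 1) * 2 ^ e := by
      rw [← pow_add]
      congr 1
      omega
    have h4 : F % 2 ^ (i + 1) < 2 ^ (i + 1) := Nat.mod_lt _ (by positivity)
    rw [h1, h2, h3]
    rcases Nat.mod_two_eq_zero_or_one (F / 2 ^ (i + 1)) with h | h
    · rw [h, mul_zero, add_zero, if_neg (by
        rw [not_le]
        exact Nat.mul_lt_mul_of_pos_right h4 (by positivity)), zero_add]
    · rw [h, mul_one, if_pos (Nat.mul_le_mul_right _ (by omega)), add_mul, add_comm]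

end

/-! ### Realizing the cost by edge weights -/

namespace TerminalNetwork

variable {k : ℕ} {V : Type*}

/-- The total cost of the edges between `X` and its complement, as a function of the costs. -/
noncomputable def cutSum [Finite V] (G : SimpleGraph V) (X : Set V) : (Sym2 V → ℕ) →ₗ[ℕ] ℕ :=
  ∑ e ∈ (Set.toFinite {e | e ∈ G.edgeSet ∧ ∃ u ∈ X, ∃ v ∉ X, e = s(u, v)}).toFinset,
    LinearMap.proj e

theorem cutCost_eq_cutSum [Finite V] (N : TerminalNetwork k V) (c : Sym2 V → ℕ)
    (hc : ∀ e, N.cost e = c e) (X : Set V) : N.cutCost X = cutSum N.graph X c := by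
  rw [cutCost_eq_sum, cutSum, LinearMap.sum_apply]
  push_cast
  exact Finset.sum_congr rfl fun e _ => hc e

open Classical in
-- The degenerate case `u = v` is admitted because `gridPoint` clamps coordinates: a step out of the
-- grid becomes a loop, which no cut contains.
theorem cutSum_single [Finite V] [DecidableEq V] (G : SimpleGraph V) (X : Set V) {u v : V}
    (h : G.Adj u v ∨ u = v) :
    cutSum G X (Pi.single s(u, v) 1) = if (u ∈ X ↔ v ∈ X) then 0 else 1 := by
  rw [cutSum, LinearMap.sum_apply]
  simp only [LinearMap.proj_apply, Pi.single_apply]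
  rw [Finset.sum_ite_eq']
  have hiff : s(u, v) ∈ (Set.toFinite {e | e ∈ G.edgeSet ∧
      ∃ u ∈ X, ∃ v ∉ X, e = s(u, v)}).toFinset ↔ ¬(u ∈ X ↔ v ∈ X) := by
    rw [Set.Finite.mem_toFinset, Set.mem_ofPred_eq]
    constructor
    · rintro ⟨-, a, ha, b, hb, hab⟩
      rcases Sym2.eq_iff.1 hab with ⟨rfl, rfl⟩ | ⟨rfl, rfl⟩ <;> tauto
    · intro hne
      refine ⟨?_, ?_⟩
      · rcases h with h | rfl
        · exact h
        · exact absurd Iff.rfl hne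
      · by_cases hu : u ∈ X
        · exact ⟨u, hu, v, by tauto, rfl⟩
        · exact ⟨v, by tauto, u, hu, Sym2.eq_swap⟩
  simp only [hiff, ite_not]

end TerminalNetwork

open TerminalNetwork

/-- The point of the grid in column `x` and row `y`, moved into the grid if necessary. -/
def gridPoint (w h x y : ℕ) : Fin (w + 1) × Fin (h + 1) :=
  (⟨min x w, by omega⟩, ⟨min y h, by omega⟩)

noncomputable def rowCost (w h y s t : ℕ) : Sym2 (Fin (w + 1) × Fin (h + 1)) → ℕ :=
  ∑ x ∈ Finset.Ico s t, Pi.single s(gridPoint w h x y, gridPoint w h (x + 1) y) 1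

noncomputable def columnCost (w h x s t : ℕ) : Sym2 (Fin (w + 1) × Fin (h + 1)) → ℕ :=
  ∑ y ∈ Finset.Ico s t, Pi.single s(gridPoint w h x y, gridPoint w h x (y + 1)) 1

theorem cutSum_rowCost (w h y s t : ℕ) (X : Set (Fin (w + 1) × Fin (h + 1))) :
    cutSum (gridGraph w h) X (rowCost w h y s t) = jumps (fun x => gridPoint w h x y ∈ X) s t := by
  classical
  rw [rowCost, map_sum, jumps, Finset.card_filter]
  refine Finset.sum_congr rfl fun x _ => ?_
  rw [cutSum_single]
  · simp only [ite_not]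
  · by_cases hx : x < w
    · left
      left
      simp [gridPoint]
      omega
    · right
      simp [gridPoint]
      omega

theorem cutSum_columnCost (w h x s t : ℕ) (X : Set (Fin (w + 1) × Fin (h + 1))) :
    cutSum (gridGraph w h) X (columnCost w h x s t) =
      jumps (fun y => gridPoint w h x y ∈ X) s t := by
  classical
  rw [columnCost, map_sum, jumps, Finset.card_filter]
  refine Finset.sum_congr rfl fun y _ => ?_
  rw [cutSum_single]
  · simp only [ite_not]
  · by_cases hy : y < h
    · left
      right
      simp [gridPoint]
      omega
    · right
      simp [gridPoint]
      omega

noncomputable def stripEdgeCost (w h n x : ℕ) : Sym2 (Fin (w + 1) × Fin (h + 1)) → ℕ :=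
  ∑ b ∈ Finset.Ico 1 n,
    ((rowCost w h (2 * b) x (x + b) + columnCost w h (x + b) b (2 * b) +
        rowCost w h b (x + b) (x + n)) +
      (rowCost w h (2 * b) x (x + (n - b)) + columnCost w h (x + (n - b)) (2 * b) (b + n) +
        rowCost w h (b + n) (x + (n - b)) (x + n)))

theorem cutSum_stripEdgeCost (w h n x : ℕ) (X : Set (Fin (w + 1) × Fin (h + 1))) :
    cutSum (gridGraph w h) X (stripEdgeCost w h n x) =
      stripJumps (fun x y => gridPoint w h x y ∈ X) n x := by
  simp only [stripEdgeCost, map_sum, map_add, cutSum_rowCost, cutSum_columnCost]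
  rfl

/-- Overlapping paths add their weights. An edge on no path gets cost 0 and becomes positive only
through the perturbation. -/
noncomputable def gridEdgeCost (d : ℕ) : Sym2 (Fin (d * 2 ^ d + 1) × Fin (2 * 2 ^ d + 1)) → ℕ :=
  ((d + 2) * (2 * 2 ^ d + 1) ^ d) •
      (rowCost _ _ 0 0 (d * 2 ^ d) + rowCost _ _ (2 * 2 ^ d) 0 (d * 2 ^ d)) +
    (2 * 2 ^ d + 1) ^ d • ∑ i ∈ Finset.range (d + 1), columnCost _ _ (i * 2 ^ d) 0 (2 * 2 ^ d) +
    (2 * 2 ^ d + 1) ^ d • (columnCost _ _ 0 1 (2 ^ d) + columnCost _ _ 0 (2 ^ d + 1) (2 * 2 ^ d)) +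
    ∑ i ∈ Finset.range d,
      (2 * 2 ^ d + 1) ^ (d - 1 - i) • stripEdgeCost _ _ (2 ^ d) (i * 2 ^ d)

theorem cutSum_gridEdgeCost (d : ℕ) (X : Set (Fin (d * 2 ^ d + 1) × Fin (2 * 2 ^ d + 1))) :
    cutSum (gridGraph _ _) X (gridEdgeCost d) =
      gridCost d fun x y => gridPoint (d * 2 ^ d) (2 * 2 ^ d) x y ∈ X := by
  simp only [gridEdgeCost, map_sum, map_add, map_smul, cutSum_rowCost, cutSum_columnCost,
    cutSum_stripEdgeCost, smul_eq_mul]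
  rfl

theorem gridPoint_inj {w h x y x' y' : ℕ} (hx : x ≤ w) (hy : y ≤ h) (hx' : x' ≤ w) (hy' : y' ≤ h) :
    gridPoint w h x y = gridPoint w h x' y' ↔ x = x' ∧ y = y' := by
  simp [gridPoint, hx, hy, hx', hy']

/-! ### The terminal network and the conclusion -/

/-- The terminals of the grid: the middles of the columns `i * 2 ^ d`, the top and the bottom. -/
def gridTerminal (d : ℕ) : Fin (d + 3) ↪ Fin (d * 2 ^ d + 1) × Fin (2 * 2 ^ d + 1) where
  toFun t := if (t : ℕ) ≤ d then gridPoint _ _ (t * 2 ^ d) (2 ^ d) else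
    if (t : ℕ) = d + 1 then gridPoint _ _ 0 0 else gridPoint _ _ 0 (2 * 2 ^ d)
  inj' := by
    intro t t' h
    have hn : 0 < 2 ^ d := by positivity
    have hW : ∀ i ≤ d, i * 2 ^ d ≤ d * 2 ^ d := fun i hi => Nat.mul_le_mul_right _ hi
    rw [Fin.ext_iff]
    have ht := t.2
    have ht' := t'.2
    simp only at h
    split_ifs at h with h1 h2 h3 h4 h5 h6 h7 h8
    · rw [gridPoint_inj (hW _ h1) (by omega) (hW _ h2) (by omega)] at h
      exact Nat.eq_of_mul_eq_mul_right hn h.1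
    · rw [gridPoint_inj (hW _ h1) (by omega) (by omega) (by omega)] at h
      omega
    · rw [gridPoint_inj (hW _ h1) (by omega) (by omega) (by omega)] at h
      omega
    · rw [gridPoint_inj (by omega) (by omega) (hW _ (by omega)) (by omega)] at h
      omega
    · omega
    · rw [gridPoint_inj (by omega) (by omega) (by omega) (by omega)] at h
      omega
    · rw [gridPoint_inj (by omega) (by omega) (hW _ (by omega)) (by omega)] at h
      omega
    · rw [gridPoint_inj (by omega) (by omega) (by omega) (by omega)] at h
      omega
    · omega

theorem gridTerminal_apply (d : ℕ) (t : Fin (d + 3)) :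
    gridTerminal d t = if (t : ℕ) ≤ d then gridPoint _ _ (t * 2 ^ d) (2 ^ d) else
      if (t : ℕ) = d + 1 then gridPoint _ _ 0 0 else gridPoint _ _ 0 (2 * 2 ^ d) := rfl

noncomputable def gridNetwork (d : ℕ) :
    TerminalNetwork (d + 3) (Fin (d * 2 ^ d + 1) × Fin (2 * 2 ^ d + 1)) where
  graph := gridGraph _ _
  cost e := gridEdgeCost d e
  cost_nonneg _ _ := Nat.cast_nonneg _
  terminal := gridTerminal d

theorem cutCost_gridNetwork (d : ℕ) (X : Set (Fin (d * 2 ^ d + 1) × Fin (2 * 2 ^ d + 1))) :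
    (gridNetwork d).cutCost X = gridCost d fun x y => gridPoint (d * 2 ^ d) (2 * 2 ^ d) x y ∈ X := by
  rw [cutCost_eq_cutSum _ (gridEdgeCost d) fun _ => rfl]
  exact congrArg _ (cutSum_gridEdgeCost d X)

/-- The terminals on the same side of an optimal cut as the top of the grid. -/
def topTerminals (d : ℕ) (J : ℕ → ℕ) : Set (Fin (d + 3)) :=
  {t | ((t : ℕ) ≤ d ∧ 2 ^ d ≤ J t) ∨ (t : ℕ) = d + 1}

theorem separates_gridNetwork_iff {d : ℕ} {J : ℕ → ℕ}
    {X : Set (Fin (d * 2 ^ d + 1) × Fin (2 * 2 ^ d + 1))} :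
    (gridNetwork d).Separates (topTerminals d J) X ↔
      gridPoint _ _ 0 0 ∈ X ∧ gridPoint _ _ 0 (2 * 2 ^ d) ∉ X ∧
        ∀ i ≤ d, (gridPoint _ _ (i * 2 ^ d) (2 ^ d) ∈ X ↔ 2 ^ d ≤ J i) := by
  constructor
  · intro h
    refine ⟨?_, ?_, fun i hi => ?_⟩
    · simpa [gridNetwork, gridTerminal_apply, topTerminals] using h ⟨d + 1, by omega⟩
    · simpa [gridNetwork, gridTerminal_apply, topTerminals] using h ⟨d + 2, by omega⟩
    · have := h ⟨i, by omega⟩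
      simpa [gridNetwork, gridTerminal_apply, topTerminals, hi, show i ≠ d + 1 by omega] using this
  · rintro ⟨h1, h2, h3⟩ ⟨t, ht⟩
    by_cases htd : t ≤ d
    · simpa [gridNetwork, gridTerminal_apply, topTerminals, htd, show t ≠ d + 1 by omega] using h3 t htd
    · by_cases htd' : t = d + 1
      · simpa [gridNetwork, gridTerminal_apply, topTerminals, htd'] using h1
      · simpa [gridNetwork, gridTerminal_apply, topTerminals, htd, htd'] using h2

theorem theorem1 (k : ℕ) (hk : 3 ≤ k) :
    ∃ (V : Type) (_ : Finite V) (N : TerminalNetwork k V),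
      IsPlanarGraph N.graph ∧
      (∀ e ∈ N.graph.edgeSet, 0 < N.cost e) ∧
      ∀ (W : Type*) [Finite W] (M : TerminalNetwork k W),
        M.IsMimickingNetwork N → 2 ^ (k - 2) ≤ M.graph.edgeSet.ncard := by
  obtain ⟨d, rfl⟩ := Nat.exists_eq_add_of_le' hk
  -- Bit `i` of `F` decides whether `2 ^ d ≤ J F i`, that is, the side of the middle terminal in
  -- column `i * 2 ^ d`.
  let J : Fin (2 ^ (d + 1)) → ℕ → ℕ := fun F i => F % 2 ^ (i + 1) * 2 ^ (d - i)
  have hJ : ∀ F, IsShiftSequence d (J F) := fun F => isShiftSequence_mod d F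
  have hJd : ∀ F, J F d = F := by
    intro F
    simp [J, Nat.mod_eq_of_lt F.2]
  have hn : 0 < 2 ^ d := by positivity
  have hFlt : ∀ F : Fin (2 ^ (d + 1)), (F : ℕ) < 2 * 2 ^ d := by
    intro F
    have h1 := F.2
    have h2 : 2 ^ (d + 1) = 2 * 2 ^ d := pow_succ' 2 d
    omega
  let X : Fin (2 ^ (d + 1)) → Set (Fin (d * 2 ^ d + 1) × Fin (2 * 2 ^ d + 1)) :=
    fun F => {p | (p.2 : ℕ) ≤ cutHeight d (J F) p.1}
  have hX : ∀ F, ∀ x ≤ d * 2 ^ d, ∀ y ≤ 2 * 2 ^ d,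
      (gridPoint _ _ x y ∈ X F ↔ y ≤ cutHeight d (J F) x) := by
    intro F x hx y hy
    simp [X, gridPoint, hx, hy]
  obtain ⟨N, hgraph, hpos, hN⟩ := (gridNetwork d).exists_perturbation (fun e => ⟨_, rfl⟩)
    (fun F => topTerminals d (J F))
    -- The private edge of `F`: the edge of the last column between rows `F` and `F + 1`.
    (fun F => s(gridPoint _ _ (d * 2 ^ d) F, gridPoint _ _ (d * 2 ^ d) (F + 1))) X
    (by
      intro F
      rw [separates_gridNetwork_iff, hX F _ (by omega) _ (by omega),
        hX F _ (by omega) _ le_rfl]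
      refine ⟨Nat.zero_le _, not_le.2 (cutHeight_lt (hJ F) (Nat.zero_le _)), fun i hi => ?_⟩
      rw [hX F _ (Nat.mul_le_mul_right _ hi) _ (by omega), cutHeight_mul])
    (by
      intro F Y hY hle F'
      rw [separates_gridNetwork_iff] at hY
      rw [cutCost_gridNetwork, cutCost_gridNetwork, Nat.cast_le] at hle
      have key := iff_le_of_gridCost_le (hJ F) hY.1 hY.2.1 hY.2.2
        (hle.trans (gridCost_le (hJ F) (hX F)))
      rw [hJd] at key
      have h1 := key F' (hFlt F').le
      have h2 := key (F' + 1) (hFlt F')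
      rw [Fin.ext_iff]
      constructor
      · rintro ⟨-, u, hu, v, hv, huv⟩
        rcases Sym2.eq_iff.1 huv with ⟨rfl, rfl⟩ | ⟨rfl, rfl⟩
        · rw [h1] at hu
          rw [h2] at hv
          omega
        · rw [h1] at hv
          rw [h2] at hu
          omega
      · intro h
        refine ⟨?_, _, h1.2 h.le, _, fun h' => ?_, rfl⟩
        · right
          have := hFlt F'
          simp [gridPoint]
          omega
        · have := h2.1 h'
          omega)
  refine ⟨_, inferInstance, N, ?_, hpos, fun W _ M hM => ?_⟩
  · rw [hgraph]
    exact isPlanarGraph_gridGraph _ _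
  · simpa using hN W M hM
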